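/- A (base-3) string is a finite word in the digits $0,1,2$. One iteration of the base-3 Look and Say process replaces, from left to right, every maximal run of $k$ consecutive equal digits $d$ by the base-3 numeral of $k$ (most significant digit first) followed by $d$; let $S_n$ denote the $n$-th iterate of $S$, with $S_0=S$. A string $S$ splits as $P^{(1)}.P^{(2)}.\cdots.P^{(k)}$ if $S_n=P^{(1)}_nP^{(2)}_n\cdots P^{(k)}_n$ (concatenation) for all $n\ge 0$. The 24 common particles are the strings \[10,\ 1110,\ 110,\ 2110,\ 122110,\ 11222110,\ 22110,\ 222110\quad(\text{fermions}),\] \[211,\ 1221,\ 112211,\ 12221,\ 2,\ 12,\ 1112,\ 112,\ 2112,\ 122112,\ 11222112,\ 22112,\ 222112\quad(\text{bosons}),\] \[22,\ 11110,\ 11112\quad(\text{neutrinos}).\] A string $S$ is eventually common if some iterate $S_n$ splits as a (possibly empty) concatenation of common particles, repetitions allowed. An essential ancient string is a string that has at most 16 digits, has no run of a single digit of length 4 or more, and contains at most one $0$, which, if it occurs, is the final digit. **Cosmological Theorem.** For every essential ancient string $S$ there is an $n\le 10$ such that $S_n$ splits as a concatenation of common particles. Moreover, every string is eventually common. -/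

import Mathlib

/-- Base-3 strings: finite words in the digits `0`, `1`, `2`. -/
abbrev TernaryString : Type := List (Fin 3)

namespace TernaryString

/-- The run-length decomposition of a string: the list of its maximal runs, from left to right,
each given as the pair (length of the run, repeated digit). -/
def runs : TernaryString → List (ℕ × Fin 3)
  | [] => []
  | a :: l =>
    match runs l with
    | [] => [(1, a)]
    | (n, b) :: t => if a = b then (n + 1, b) :: t else (1, a) :: (n, b) :: t

/-- The base-3 numeral of a natural number, most significant digit first. -/
def numeral (n : ℕ) : TernaryString := (Nat.digits 3 n).reverse.map (Fin.ofNat 3)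

/-- One iteration of the base-3 Look and Say process: every maximal run of `n` digits `d` is
replaced by the base-3 numeral of `n` followed by the digit `d`. -/
def lookSay (S : TernaryString) : TernaryString :=
  (runs S).flatMap fun r => numeral r.1 ++ [r.2]

/-- `iter n S` is the `n`-th iterate `Sₙ` of the string `S`. -/
def iter (n : ℕ) (S : TernaryString) : TernaryString := lookSay^[n] S

/-- `S` splits as the concatenation `P₁.P₂.⋯.Pₖ` of the listed strings: for every `n` (including
`n = 0`) the `n`-th iterate of `S` is the concatenation of the `n`-th iterates of the `Pᵢ`. -/
def SplitsAs (S : TernaryString) (P : List TernaryString) : Prop :=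
  ∀ n : ℕ, iter n S = (P.map (iter n)).flatten

/-- The eight fermions E, M, U, D, S, C, B, T. -/
def fermions : List TernaryString :=
  [[1, 0], [1, 1, 1, 0], [1, 1, 0], [2, 1, 1, 0], [1, 2, 2, 1, 1, 0],
    [1, 1, 2, 2, 2, 1, 1, 0], [2, 2, 1, 1, 0], [2, 2, 2, 1, 1, 0]]

/-- The thirteen bosons Ph, Gl, Wb, Zb, H, Se, Sm, Su, Sd, Ss, Sc, Sb, St. -/
def bosons : List TernaryString :=
  [[2, 1, 1], [1, 2, 2, 1], [1, 1, 2, 2, 1, 1], [1, 2, 2, 2, 1], [2],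
    [1, 2], [1, 1, 1, 2], [1, 1, 2], [2, 1, 1, 2], [1, 2, 2, 1, 1, 2],
    [1, 1, 2, 2, 2, 1, 1, 2], [2, 2, 1, 1, 2], [2, 2, 2, 1, 1, 2]]

/-- The three neutrinos Ne, Nm, Nt. -/
def neutrinos : List TernaryString :=
  [[2, 2], [1, 1, 1, 1, 0], [1, 1, 1, 1, 2]]

/-- The 24 common base-3 particles. -/
def commonParticles : List TernaryString := fermions ++ bosons ++ neutrinos

/-- `S` splits as a concatenation of common particles (repetitions allowed). -/
def SplitsIntoCommon (S : TernaryString) : Prop :=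
  ∃ P : List TernaryString, (∀ p ∈ P, p ∈ commonParticles) ∧ SplitsAs S P

/-- `S` is eventually common: some iterate of `S` splits as a concatenation of common
particles. -/
def EventuallyCommon (S : TernaryString) : Prop :=
  ∃ n : ℕ, SplitsIntoCommon (iter n S)

/-- Essential ancient strings: at most 16 digits; no run of length 4 or more (no four equal
consecutive digits); and no digit `0` except possibly the last digit. -/
structure EssentialAncient (S : TernaryString) : Prop where
  length_le : S.length ≤ 16
  no_long_run : ∀ d : Fin 3, ¬ List.replicate 4 d <:+: S
  zero_notMem : (0 : Fin 3) ∉ S.dropLast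

end TernaryString

/-!
The proof rests on a decomposition of strings into common particles that can be read off digit by
digit, and on a finite search.

A concatenation `A ++ B` splits for good as soon as no iterate of `B` starts with the last digit of
`A`, because an iteration preserves the last digit of a string (`iter_append`). No iterate of a
common particle starts with `0`; seven common particles always start with `1`, and `22` is a fixed
point. This yields a simple condition (`separable`) under which one common particle may follow
another, and a list of particles that meets it, an `IsParticleChain`, is a splitting
(`IsParticleChain.splitsAs`). It remains to see that late iterates are chains of particles.

One iteration can be carried out while a string is read from right to left: all that has to be
remembered is the run being read. So an automaton `M` for a property of strings gives an automaton
`M.look` for the property of `lookSay S` (`Reader.accept_look`), and its `n`-fold `look` decides the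
property for `iter n S`. Applied to the automaton `parser`, which cuts a string greedily into a
chain of particles, this turns the claim "`iter n S` is a chain of particles for all `S` of a given
language" into the claim that the reachable states are all accepting. For the languages in question
only a few hundred states are reachable, although the strings are of arbitrary length. They are
enumerated by `explore`, evaluated in the kernel; `accept_of_explore` says that the search is sound.

For strings without runs of length four or more, and with `0` at most in the last place, ten
iterations suffice (`explore_essential`); the bound of 16 on the length is not needed. For an
arbitrary string, a run of length less than `3 ^ l` is described by at most `l + 1` digits, and
successive descriptions end in different digits, so that the runs after one more iteration have
length at most `2 * l + 1`. Hence eventually all runs have length at most five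
(`exists_runsLE_five`), and two iterations later runs of `0`, `1`, `2` have length at most `1`, `4`,
`3` (`RunsLE.iter_two`, by a search again). Such a string is cut behind its zeros, and the pieces
become chains of particles within eleven iterations (`explore_lateBound`, `RunsLE.decomposes`).
-/

namespace TernaryString

/-! ### Runs -/

theorem head?_runs (S : TernaryString) : (runs S).head?.map Prod.snd = S.head? := by
  cases S with
  | nil => rfl
  | cons a l =>
    simp only [runs]
    split
    · simp
    · split_ifs with h <;> simp [h]

theorem runs_ne_nil {S : TernaryString} (h : S ≠ []) : runs S ≠ [] := by
  intro h0
  have := head?_runs S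
  rw [h0] at this
  cases S <;> simp_all

theorem runs_cons_of_head?_ne {a : Fin 3} {l : TernaryString} (h : l.head? ≠ some a) :
    runs (a :: l) = (1, a) :: runs l := by
  have h1 := head?_runs l
  simp only [runs]
  split
  · simp_all
  · rename_i n b t ht
    rw [ht] at h1
    have : a ≠ b := by rintro rfl; exact h (by simpa using h1.symm)
    simp [this, ht]

theorem runs_cons_of_runs_eq {a : Fin 3} {l : TernaryString} {n : ℕ} {t : List (ℕ × Fin 3)}
    (h : runs l = (n, a) :: t) : runs (a :: l) = (n + 1, a) :: t := by
  simp [runs, h]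

theorem runs_append {A B : TernaryString} (h : ∀ d ∈ A.getLast?, B.head? ≠ some d) :
    runs (A ++ B) = runs A ++ runs B := by
  induction A with
  | nil => rfl
  | cons a l ih =>
    cases l with
    | nil =>
      have := h a (by simp)
      simp [runs_cons_of_head?_ne this, runs]
    | cons b l =>
      have ih := ih (by simpa using h)
      rcases hr : runs (b :: l) with _ | ⟨⟨n, c⟩, t⟩
      · exact absurd hr (runs_ne_nil (by simp))
      · rw [hr] at ih
        rw [List.cons_append, runs, ih, runs, hr]
        simp only [List.cons_append]
        split_ifs <;> rfl

theorem pos_of_mem_runs {S : TernaryString} : ∀ r ∈ runs S, 0 < r.1 := by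
  induction S with
  | nil => simp [runs]
  | cons a l ih =>
    simp only [runs]
    split
    · simp
    · rename_i h
      rw [h] at ih
      split_ifs <;> simp_all <;> exact ih.2

theorem flatMap_replicate_runs (S : TernaryString) :
    (runs S).flatMap (fun r => List.replicate r.1 r.2) = S := by
  induction S with
  | nil => rfl
  | cons a l ih =>
    simp only [runs]
    split
    · simp_all
    · rename_i h
      rw [h] at ih
      split_ifs with hab
      · subst hab
        simpa [List.replicate_succ] using ih
      · simpa using ih

theorem isChain_runs (S : TernaryString) : (runs S).IsChain fun r s => r.2 ≠ s.2 := by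
  induction S with
  | nil => simp [runs]
  | cons a l ih =>
    simp only [runs]
    split
    · simp
    · rename_i n b t h
      rw [h] at ih
      split_ifs with hab
      · cases t <;> simp_all
      · exact List.isChain_cons_cons.2 ⟨hab, ih⟩

/-! ### One iteration -/

theorem numeral_ne_nil {n : ℕ} (h : 0 < n) : numeral n ≠ [] := by
  simp [numeral, Nat.digits_eq_nil_iff_eq_zero, h.ne']

theorem head?_numeral_ne_zero (n : ℕ) : (numeral n).head? ≠ some 0 := by
  rcases Nat.eq_zero_or_pos n with rfl | h
  · simp [numeral]
  have hne : Nat.digits 3 n ≠ [] := by simp [Nat.digits_eq_nil_iff_eq_zero, h.ne']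
  have h0 := Nat.getLast_digit_ne_zero 3 h.ne'
  have hlt : (Nat.digits 3 n).getLast hne < 3 :=
    Nat.digits_lt_base (by norm_num) (List.getLast_mem hne)
  rw [numeral, List.head?_map, List.head?_reverse, List.getLast?_eq_some_getLast hne]
  intro h1
  have h2 := congrArg Fin.val (Option.some.inj h1)
  simp only [Fin.ofNat, Nat.mod_eq_of_lt hlt] at h2
  exact h0 h2

theorem lookSay_append {A B : TernaryString} (h : ∀ d ∈ A.getLast?, B.head? ≠ some d) :
    lookSay (A ++ B) = lookSay A ++ lookSay B := by
  simp [lookSay, runs_append h]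

theorem head?_lookSay_ne_zero (S : TernaryString) : (lookSay S).head? ≠ some 0 := by
  have hp := @pos_of_mem_runs S
  unfold lookSay
  cases hr : runs S with
  | nil => simp
  | cons r t =>
    have : numeral r.1 ≠ [] := numeral_ne_nil (hp r (by simp [hr]))
    have h0 := head?_numeral_ne_zero r.1
    cases hn : numeral r.1 with
    | nil => exact absurd hn this
    | cons a l => simpa [hn] using h0

theorem getLast?_lookSay (S : TernaryString) : (lookSay S).getLast? = S.getLast? := by
  have hp := @pos_of_mem_runs S
  conv_rhs => rw [← flatMap_replicate_runs S]
  rw [lookSay]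
  rcases List.eq_nil_or_concat (runs S) with h | ⟨t, r, h⟩
  · simp [h]
  · have h1 := hp r (by simp [h])
    obtain ⟨k, hk⟩ := Nat.exists_eq_succ_of_ne_zero h1.ne'
    simp [h, hk, List.replicate_succ']

theorem iter_succ (n : ℕ) (S : TernaryString) : iter (n + 1) S = iter n (lookSay S) :=
  Function.iterate_succ_apply _ _ _

theorem iter_succ' (n : ℕ) (S : TernaryString) : iter (n + 1) S = lookSay (iter n S) :=
  Function.iterate_succ_apply' _ _ _

theorem iter_add (m n : ℕ) (S : TernaryString) : iter (m + n) S = iter m (iter n S) :=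
  Function.iterate_add_apply _ _ _ _

theorem getLast?_iter (n : ℕ) (S : TernaryString) : (iter n S).getLast? = S.getLast? := by
  induction n with
  | zero => rfl
  | succ n ih => rw [iter_succ', getLast?_lookSay, ih]

theorem iter_ne_nil (n : ℕ) {S : TernaryString} (h : S ≠ []) : iter n S ≠ [] := by
  rw [Ne, ← List.getLast?_eq_none_iff, getLast?_iter, List.getLast?_eq_none_iff]
  exact h

theorem head?_iter_ne_zero {S : TernaryString} (h : S.head? ≠ some 0) (n : ℕ) :
    (iter n S).head? ≠ some 0 := by
  cases n with
  | zero => exact h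
  | succ n => rw [iter_succ']; exact head?_lookSay_ne_zero _

theorem iter_append {A B : TernaryString}
    (h : ∀ n, ∀ d ∈ A.getLast?, (iter n B).head? ≠ some d) (n : ℕ) :
    iter n (A ++ B) = iter n A ++ iter n B := by
  induction n with
  | zero => rfl
  | succ n ih =>
    rw [iter_succ', ih, lookSay_append, ← iter_succ', ← iter_succ']
    rw [getLast?_iter]
    exact h n

/-! ### Chains of common particles -/

/-- The common particles all of whose iterates start with the digit `1`. -/
def oneLed : List TernaryString :=
  [[1, 0], [1, 1, 1, 0], [1, 2, 2, 2, 1], [1, 2], [1, 1, 1, 2], [1, 1, 1, 1, 0], [1, 1, 1, 1, 2]]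

/-- The list of common particles `p` none of whose iterates starts with the digit `d`. -/
def separable (d : Fin 3) : List TernaryString :=
  match d with
  | 0 => commonParticles
  | 1 => [[2, 2]]
  | 2 => oneLed

/-- A shape that forces all iterates to start with `1`: a prefix `10` grows into `1110`, which
splits off a new prefix `10`, since nothing that follows a digit `0` affects it. -/
def TenLed (S : TernaryString) : Prop :=
  ∃ T : TernaryString, T.head? ≠ some 0 ∧ (S = [1, 0] ++ T ∨ S = [1, 1, 1, 0] ++ T)

theorem TenLed.lookSay {S : TernaryString} (h : TenLed S) : TenLed (lookSay S) := by
  obtain ⟨T, hT, rfl | rfl⟩ := h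
  · rw [lookSay_append (by simpa using hT)]
    exact ⟨_, head?_lookSay_ne_zero T, Or.inr rfl⟩
  · rw [lookSay_append (by simpa using hT)]
    refine ⟨[1, 1, 0] ++ TernaryString.lookSay T, by simp, Or.inl ?_⟩
    rw [← List.append_assoc]
    congr 1

theorem TenLed.head?_iter {S : TernaryString} (h : TenLed S) (n : ℕ) :
    (iter n S).head? = some 1 := by
  induction n generalizing S with
  | zero => obtain ⟨T, -, rfl | rfl⟩ := h <;> rfl
  | succ n ih => rw [iter_succ]; exact ih h.lookSay

theorem iter_of_lookSay_eq {S : TernaryString} (h : lookSay S = S) (n : ℕ) : iter n S = S :=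
  Function.iterate_fixed h n

theorem head?_iter_succ {S : TernaryString} {d : Fin 3} (h0 : S.head? = some d)
    (h : ∀ n, (iter n (lookSay S)).head? = some d) (n : ℕ) : (iter n S).head? = some d := by
  cases n with
  | zero => exact h0
  | succ n => rw [iter_succ]; exact h n

theorem head?_iter_of_mem_oneLed {p : TernaryString} (h : p ∈ oneLed) (n : ℕ) :
    (iter n p).head? = some 1 := by
  simp only [oneLed, List.mem_cons, List.not_mem_nil, or_false] at h
  rcases h with rfl | rfl | rfl | rfl | rfl | rfl | rfl
  · exact TenLed.head?_iter ⟨[], by simp, Or.inl rfl⟩ n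
  · exact TenLed.head?_iter ⟨[], by simp, Or.inr rfl⟩ n
  · refine head?_iter_succ rfl (fun n => ?_) n
    exact TenLed.head?_iter ⟨[2, 1, 1], by simp, Or.inr (by decide)⟩ n
  · refine head?_iter_succ rfl (fun n => head?_iter_succ (by decide) (fun n => ?_) n) n
    exact TenLed.head?_iter ⟨[1, 1, 2], by simp, Or.inl (by decide)⟩ n
  · refine head?_iter_succ rfl (fun n => ?_) n
    exact TenLed.head?_iter ⟨[1, 1, 2], by simp, Or.inl (by decide)⟩ n
  · rw [iter_of_lookSay_eq (by decide)]; rfl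
  · rw [iter_of_lookSay_eq (by decide)]; rfl

theorem head?_iter_ne_of_mem_separable {d : Fin 3} {p : TernaryString} (h : p ∈ separable d)
    (n : ℕ) : (iter n p).head? ≠ some d := by
  match d, h with
  | 0, h =>
    refine head?_iter_ne_zero ?_ n
    have : ∀ p ∈ commonParticles, p.head? ≠ some 0 := by decide
    exact this p h
  | 1, h =>
    simp only [separable, List.mem_singleton] at h
    rw [h, iter_of_lookSay_eq (by decide)]
    decide
  | 2, h =>
    rw [head?_iter_of_mem_oneLed h]
    decide

theorem mem_common_of_mem_separable {d : Fin 3} {p : TernaryString} (h : p ∈ separable d) :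
    p ∈ commonParticles := by
  have : ∀ d, ∀ p ∈ separable d, p ∈ commonParticles := by decide
  exact this d p h

theorem ne_nil_of_mem_common {p : TernaryString} (h : p ∈ commonParticles) : p ≠ [] := by
  have : ∀ p ∈ commonParticles, p ≠ [] := by decide
  exact this p h

/-- A list of common particles such that no iterate of a member starts with the last digit of the
preceding member. -/
def IsParticleChain (P : List TernaryString) : Prop :=
  (∀ p ∈ P, p ∈ commonParticles) ∧ P.IsChain fun p q => ∀ d ∈ p.getLast?, q ∈ separable d

/-- A string that is the concatenation of a particle chain. -/
def Decomposes (S : TernaryString) : Prop :=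
  ∃ P, IsParticleChain P ∧ P.flatten = S

theorem IsParticleChain.splitsAs {P : List TernaryString} (h : IsParticleChain P) :
    SplitsAs P.flatten P := by
  induction P with
  | nil =>
    intro n
    simpa using iter_of_lookSay_eq (S := []) rfl n
  | cons p Q ih =>
    obtain ⟨hc, hch⟩ := h
    have ih := ih ⟨fun q hq => hc q (List.mem_cons_of_mem _ hq), hch.tail⟩
    intro n
    rw [List.flatten_cons, iter_append, ih n, List.map_cons, List.flatten_cons]
    intro m d hd
    rw [ih m]
    cases Q with
    | nil => simp
    | cons q Q =>
      have hq := (List.isChain_cons_cons.1 hch).1 d hd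
      have hne := iter_ne_nil m (ne_nil_of_mem_common (hc q (by simp)))
      have := head?_iter_ne_of_mem_separable hq m
      rw [List.map_cons, List.flatten_cons, List.head?_append_of_ne_nil _ hne]
      exact this

theorem Decomposes.splitsIntoCommon {S : TernaryString} (h : Decomposes S) :
    SplitsIntoCommon S := by
  obtain ⟨P, hP, rfl⟩ := h
  exact ⟨P, hP.1, hP.splitsAs⟩

theorem Decomposes.append {A B : TernaryString} (hA : Decomposes A) (hB : Decomposes B)
    (h0 : A.getLast? = some 0) : Decomposes (A ++ B) := by
  obtain ⟨P, hP, rfl⟩ := hA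
  obtain ⟨Q, hQ, rfl⟩ := hB
  refine ⟨P ++ Q, ⟨?_, hP.2.append hQ.2 ?_⟩, by simp⟩
  · intro p hp
    exact (List.mem_append.1 hp).elim (hP.1 p) (hQ.1 p)
  · intro p hp q hq d hd
    obtain ⟨P', rfl⟩ : ∃ P', P = P' ++ [p] := by
      rw [Option.mem_def, List.getLast?_eq_some_iff] at hp
      exact hp
    have hne := ne_nil_of_mem_common (hP.1 p (by simp))
    have : d = 0 := by
      simp only [List.flatten_append, List.flatten_singleton,
        List.getLast?_append_of_ne_nil _ hne] at h0
      rw [Option.mem_def, h0] at hd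
      exact (Option.some.inj hd).symm
    subst this
    exact hQ.1 q (List.mem_of_mem_head? hq)

/-! ### Bounded runs -/

/-- Every maximal run of the digit `d` in `S` has length at most `b d`. -/
def RunsLE (b : Fin 3 → ℕ) (S : TernaryString) : Prop := ∀ r ∈ runs S, r.1 ≤ b r.2

theorem replicate_infix_of_mem_runs {S : TernaryString} {r : ℕ × Fin 3} (h : r ∈ runs S) :
    List.replicate r.1 r.2 <:+: S := by
  obtain ⟨s, t, hst⟩ := List.append_of_mem h
  rw [← flatMap_replicate_runs S, hst]
  simp only [List.flatMap_append, List.flatMap_cons, ← List.append_assoc]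
  exact List.infix_append _ _ _

theorem runsLE_of_not_infix {b : Fin 3 → ℕ} {S : TernaryString}
    (h : ∀ d, ¬ List.replicate (b d + 1) d <:+: S) : RunsLE b S := by
  intro r hr
  by_contra! hlt
  refine h r.2 (List.IsInfix.trans ?_ (replicate_infix_of_mem_runs hr))
  obtain ⟨k, hk⟩ := Nat.exists_eq_add_of_le (Nat.succ_le_of_lt hlt)
  rw [hk, List.replicate_add (b r.2).succ k]
  exact (List.prefix_append _ _).isInfix

theorem RunsLE.of_cons {b : Fin 3 → ℕ} {a : Fin 3} {l : TernaryString} (h : RunsLE b (a :: l)) :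
    RunsLE b l := by
  intro r hr
  rcases hl : runs l with _ | ⟨⟨n, c⟩, t⟩
  · simp [hl] at hr
  by_cases hac : a = c
  · subst hac
    unfold RunsLE at h
    rw [runs_cons_of_runs_eq hl] at h
    rw [hl] at hr
    rcases List.mem_cons.1 hr with rfl | hr
    · have := h (n + 1, a) (by simp)
      simp only at this ⊢
      omega
    · exact h r (by simp [hr])
  · refine h r ?_
    rw [runs, hl]
    simp only [hac, if_false]
    rw [hl] at hr
    exact List.mem_cons_of_mem _ hr

theorem length_numeral_le {n l : ℕ} (h : n < 3 ^ l) : (numeral n).length ≤ l := by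
  simpa [numeral] using (Nat.digits_length_le_iff (by norm_num) n).2 h

/-- A window of length `2 * l + 2` that starts in the block of a run either lies in that block,
which is too short, or reaches the final digit of the next block too. -/
theorem not_replicate_infix_flatMap {l : ℕ} {R : List (ℕ × Fin 3)}
    (hl : ∀ r ∈ R, r.1 < 3 ^ l) (hR : R.IsChain fun r s => r.2 ≠ s.2) (d : Fin 3) :
    ¬ List.replicate (2 * l + 1 + 1) d <:+: R.flatMap fun r => numeral r.1 ++ [r.2] := by
  induction R with
  | nil => simp [List.replicate_succ]
  | cons r R ih =>
    have hlen := length_numeral_le (hl r (by simp))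
    intro h
    rw [List.flatMap_cons, List.infix_append_iff] at h
    rcases h with h | h | ⟨X, Y, hXY, hX, hY⟩
    · have := h.length_le
      simp at this
      omega
    · exact ih (fun s hs => hl s (by simp [hs])) hR.tail h
    · have hXl := hX.length_le
      have hsum := congrArg List.length hXY
      simp only [List.length_append, List.length_replicate, List.length_singleton] at hXl hsum
      have hXd : ∀ x ∈ X, x = d := fun x hx => List.eq_of_mem_replicate (n := 2 * l + 1 + 1)
        (by rw [hXY]; exact List.mem_append_left _ hx)
      have hYd : ∀ x ∈ Y, x = d := fun x hx => List.eq_of_mem_replicate (n := 2 * l + 1 + 1)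
        (by rw [hXY]; exact List.mem_append_right _ hx)
      cases R with
      | nil =>
        have : Y = [] := by simpa using hY
        simp only [this, List.length_nil] at hsum
        omega
      | cons s R =>
        have hlen' := length_numeral_le (hl s (by simp))
        have hs : s.2 = d := by
          refine hYd _ ?_
          have hpre : numeral s.1 ++ [s.2] <+: Y := by
            refine List.prefix_of_prefix_length_le (List.prefix_append _ _) hY ?_
            simp
            omega
          exact hpre.subset (by simp)
        have hr : r.2 = d ∨ X = [] := by
          rcases List.eq_nil_or_concat X with h | ⟨X', x, rfl⟩
          · exact Or.inr h
          · left
            obtain ⟨Z, hZ⟩ := hX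
            have := congrArg List.getLast? hZ
            simp at this
            rw [← this]
            exact hXd x (by simp)
        rcases hr with hr | rfl
        · exact (List.isChain_cons_cons.1 hR).1 (hr.trans hs.symm)
        · refine ih (fun s hs => hl s (by simp_all)) hR.tail ?_
          rw [hXY]
          exact hY.isInfix

/-- Runs of length at most `M` are described by numerals of at most `l` digits as soon as
`M < 3 ^ l`, which bounds the next runs logarithmically in `M`. -/
theorem RunsLE.lookSay {M l : ℕ} {S : TernaryString} (h : RunsLE (fun _ => M) S)
    (hM : M < 3 ^ l) : RunsLE (fun _ => 2 * l + 1) (lookSay S) :=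
  runsLE_of_not_infix fun d => not_replicate_infix_flatMap
    (fun r hr => (h r hr).trans_lt hM) (isChain_runs S) d

theorem exists_runsLE_five (S : TernaryString) : ∃ n, RunsLE (fun _ => 5) (iter n S) := by
  obtain ⟨M, hM⟩ : ∃ M, RunsLE (fun _ => M) S :=
    ⟨S.length, fun r hr => by simpa using (replicate_infix_of_mem_runs hr).length_le⟩
  induction M using Nat.strong_induction_on generalizing S with
  | _ M ih =>
    by_cases h8 : M < 3 ^ 2
    · exact ⟨1, hM.lookSay h8⟩
    -- With `l = (M - 2) / 2` both `M < 3 ^ l` and `2 * l + 1 < M` hold for `M ≥ 9`.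
    obtain ⟨l, hl3, hlM, hMl⟩ : ∃ l, 3 ≤ l ∧ 2 * l + 1 < M ∧ M ≤ 2 * l + 3 :=
      ⟨(M - 2) / 2, by omega, by omega, by omega⟩
    have hpow : ∀ k, 3 ≤ k → 2 * k + 3 < 3 ^ k := by
      intro k hk
      induction k, hk using Nat.le_induction with
      | base => norm_num
      | succ k _ ihk => rw [pow_succ]; omega
    obtain ⟨n, hn⟩ := ih (2 * l + 1) hlM _ (hM.lookSay (hMl.trans_lt (hpow l hl3)))
    exact ⟨n + 1, by rwa [iter_succ]⟩

/-! ### Automata reading strings from right to left -/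

/-- A deterministic automaton, not necessarily finite, that reads a string from right to left. -/
structure Reader (σ : Type) where
  /-- The state before the last digit is read. -/
  init : σ
  /-- The state after one more digit is read. -/
  step : Fin 3 → σ → σ
  /-- Whether a string that leads to the given state is accepted. -/
  accept : σ → Bool

theorem beq_val (a b : Fin 3) : Nat.beq a.val b.val = decide (a = b) := by
  decide +revert

theorem beq_val_zero (a : Fin 3) : Nat.beq a.val 0 = decide (a = 0) := beq_val a 0

namespace Reader

variable {σ : Type}

/-- The state of a reader after the whole of a string. -/
def read (M : Reader σ) (S : TernaryString) : σ := S.foldr M.step M.init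

/-- The state after `numeral n ++ [e]`, the description of a run of `n` digits `e`, is read from
state `q`; the state `q` itself if `n = 0`. The numerals of the small `n` are spelled out to speed
up evaluation. -/
def flush (M : Reader σ) (n : ℕ) (e : Fin 3) (q : σ) : σ :=
  bif Nat.beq n 1 then M.step 1 (M.step e q) else
  bif Nat.beq n 2 then M.step 2 (M.step e q) else
  bif Nat.beq n 3 then M.step 1 (M.step 0 (M.step e q)) else
  bif Nat.beq n 4 then M.step 1 (M.step 1 (M.step e q)) else
  bif Nat.beq n 5 then M.step 1 (M.step 2 (M.step e q)) else
  bif Nat.beq n 0 then q else (numeral n ++ [e]).foldr M.step q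

/-- The reader that accepts `S` if `M` accepts `lookSay S`. A state consists of the length and the
digit of the run being read, and of the state of `M` on the description of the completed runs. The
length is `0` before the first digit. -/
def look (M : Reader σ) : Reader (ℕ × Fin 3 × σ) where
  init := (0, 0, M.init)
  step d s := bif Nat.beq d.val s.2.1.val then (s.1 + 1, s.2.1, s.2.2)
    else (1, d, M.flush s.1 s.2.1 s.2.2)
  accept s := M.accept (M.flush s.1 s.2.1 s.2.2)

theorem flush_zero (M : Reader σ) (e : Fin 3) (q : σ) : M.flush 0 e q = q := rfl

theorem flush_of_pos (M : Reader σ) {n : ℕ} (hn : 0 < n) (e : Fin 3) (q : σ) :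
    M.flush n e q = (numeral n ++ [e]).foldr M.step q := by
  match n, hn with
  | 1, _ | 2, _ | 3, _ | 4, _ | 5, _ => rfl
  | n + 6, _ => rfl

/-- The state of `M.look` on `S`: the first run of `S`, and the state of `M` on the descriptions of
all further runs. -/
theorem read_look (M : Reader σ) (S : TernaryString) :
    M.look.read S = (((runs S).headD (0, 0)).1, ((runs S).headD (0, 0)).2,
      M.read ((runs S).tail.flatMap fun r => numeral r.1 ++ [r.2])) := by
  induction S with
  | nil => rfl
  | cons a l ih =>
    have hpos := @pos_of_mem_runs l
    change M.look.step a (M.look.read l) = _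
    rw [ih]
    rcases hl : runs l with _ | ⟨⟨n, c⟩, t⟩
    · by_cases ha : a = 0
      · subst ha
        simp [look, runs, hl]
      · simp [look, runs, hl, beq_val_zero, ha, flush_zero]
    · by_cases hac : a = c
      · subst hac
        simp [look, runs, hl]
      · have hn : 0 < n := hpos (n, c) (by simp [hl])
        simp [look, runs, hl, beq_val, hac, flush_of_pos M hn, read]

theorem accept_look (M : Reader σ) (S : TernaryString) :
    M.look.accept (M.look.read S) = M.accept (M.read (lookSay S)) := by
  have hpos := @pos_of_mem_runs S
  rw [read_look]
  change M.accept _ = _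
  rcases hl : runs S with _ | ⟨⟨n, c⟩, t⟩
  · simp [lookSay, hl, flush_zero]
  · have hn : 0 < n := hpos (n, c) (by simp [hl])
    simp [lookSay, hl, flush_of_pos M hn, read]

end Reader

/-- The states of the `n`-fold `Reader.look` of a reader with states in `σ`. -/
def LookState (σ : Type) : ℕ → Type
  | 0 => σ
  | n + 1 => ℕ × Fin 3 × LookState σ n

instance LookState.instDecidableEq {σ : Type} [DecidableEq σ] :
    (n : ℕ) → DecidableEq (LookState σ n)
  | 0 => inferInstanceAs (DecidableEq σ)
  | n + 1 =>
    have := LookState.instDecidableEq (σ := σ) n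
    inferInstanceAs (DecidableEq (ℕ × Fin 3 × LookState σ n))

/-- A search key for states, given search keys for the states of the original reader. -/
def LookState.key {σ : Type} (f : σ → ℕ) : (n : ℕ) → LookState σ n → ℕ
  | 0, q => f q
  | n + 1, (m, d, q) => Nat.add (Nat.mul 20 (LookState.key f n q)) (Nat.add (Nat.mul 3 m) d.val)

/-- The `n`-fold `Reader.look`, which accepts `S` if `M` accepts `iter n S`. -/
def Reader.lookIter {σ : Type} (M : Reader σ) : (n : ℕ) → Reader (LookState σ n)
  | 0 => M
  | n + 1 => (M.lookIter n).look

theorem Reader.accept_lookIter {σ : Type} (M : Reader σ) (n : ℕ) (S : TernaryString) :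
    (M.lookIter n).accept ((M.lookIter n).read S) = M.accept (M.read (iter n S)) := by
  induction n generalizing S with
  | zero => rfl
  | succ n ih => exact ((M.lookIter n).accept_look S).trans (ih _)

/-! ### Exhaustive search of the reachable states -/

/-- Binary search trees of states with natural numbers as keys. Distinct states may have equal
keys. -/
inductive StateTree (σ : Type)
  | leaf
  | node (l : StateTree σ) (k : ℕ) (q : σ) (r : StateTree σ)

namespace StateTree

variable {σ : Type}

/-- Whether the search for the state `q` with key `k` succeeds. -/
def find [DecidableEq σ] (k : ℕ) (q : σ) : StateTree σ → Bool
  | leaf => false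
  | node l k' q' r =>
    bif Nat.blt k k' then find k q l else
    bif Nat.beq k k' && decide (q = q') then true else find k q r

/-- Inserts the state `q` with key `k`. -/
def insert (k : ℕ) (q : σ) : StateTree σ → StateTree σ
  | leaf => node leaf k q leaf
  | node l k' q' r =>
    bif Nat.blt k k' then node (insert k q l) k' q' r else node l k' q' (insert k q r)

/-- The states stored in a tree. -/
def states : StateTree σ → Set σ
  | leaf => ∅
  | node l _ q r => {q} ∪ (l.states ∪ r.states)

theorem mem_states_of_find [DecidableEq σ] {k : ℕ} {q : σ} {t : StateTree σ}
    (h : t.find k q = true) : q ∈ t.states := by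
  induction t with
  | leaf => simp [find] at h
  | node l k' q' r ihl ihr =>
    rw [find] at h
    cases hk : Nat.blt k k' with
    | true =>
      rw [hk] at h
      exact Or.inr (Or.inl (ihl h))
    | false =>
      rw [hk] at h
      cases hq : Nat.beq k k' && decide (q = q') with
      | true =>
        simp only [Bool.and_eq_true, decide_eq_true_eq] at hq
        exact Or.inl hq.2
      | false =>
        rw [hq] at h
        exact Or.inr (Or.inr (ihr h))

theorem states_insert (k : ℕ) (q : σ) (t : StateTree σ) :
    (t.insert k q).states = {q} ∪ t.states := by
  induction t with
  | leaf => simp [insert, states]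
  | node l k' q' r ihl ihr =>
    rw [insert]
    cases Nat.blt k k'
    · simp only [cond_false, states, ihr]
      ext; simp only [Set.mem_union]; tauto
    · simp only [cond_true, states, ihl]
      ext; simp only [Set.mem_union]; tauto

end StateTree

/-- Searches all states that can be reached from the states of a worklist by steps that `allow`
permits, starting from a tree of states visited before. Returns `true` if the search ends within
the given number of rounds and all states found are accepted. -/
def explore {σ : Type} [DecidableEq σ] (key : σ → ℕ) (M : Reader σ) (allow : Fin 3 → σ → Bool) :
    ℕ → List σ → StateTree σ → Bool
  | 0, _, _ => false
  | _ + 1, [], _ => true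
  | f + 1, q :: w, t =>
    bif t.find (key q) q then explore key M allow f w t else
    bif M.accept q then
      explore key M allow f
        ((([0, 1, 2] : List (Fin 3)).filter (allow · q)).map (M.step · q) ++ w)
        (t.insert (key q) q)
    else false

section Explore

variable {σ : Type} [DecidableEq σ] {key : σ → ℕ} {M : Reader σ} {allow : Fin 3 → σ → Bool}

/-- The states found by a successful search form a set of accepted states that is closed under
allowed steps. -/
theorem exists_closed_of_explore {f : ℕ} {w : List σ} {t : StateTree σ}
    (h : explore key M allow f w t = true)
    (ht : ∀ q ∈ t.states, M.accept q = true ∧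
      ∀ d, allow d q = true → M.step d q ∈ t.states ∨ M.step d q ∈ w) :
    ∃ V : Set σ, (∀ q ∈ t.states, q ∈ V) ∧ (∀ q ∈ w, q ∈ V) ∧
      ∀ q ∈ V, M.accept q = true ∧ ∀ d, allow d q = true → M.step d q ∈ V := by
  induction f generalizing w t with
  | zero => simp [explore] at h
  | succ f ih =>
    cases w with
    | nil => exact ⟨t.states, fun _ hq => hq, by simp, by simpa using ht⟩
    | cons q w =>
      rw [explore] at h
      cases hf : t.find (key q) q with
      | true =>
        have hq := StateTree.mem_states_of_find hf
        rw [hf] at h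
        obtain ⟨V, h1, h2, h3⟩ := ih h fun p hp => ⟨(ht p hp).1, fun d hd => by
          rcases (ht p hp).2 d hd with h | h
          · exact Or.inl h
          · rcases List.mem_cons.1 h with h | h
            · exact Or.inl (h ▸ hq)
            · exact Or.inr h⟩
        exact ⟨V, h1, by simpa using ⟨h1 q hq, h2⟩, h3⟩
      | false =>
        rw [hf] at h
        cases ha : M.accept q with
        | false => simp [ha] at h
        | true =>
          rw [ha] at h
          obtain ⟨V, h1, h2, h3⟩ := ih h (by
            intro p hp
            rw [StateTree.states_insert] at hp ⊢
            rcases hp with rfl | hp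
            · refine ⟨ha, fun d hd => Or.inr (List.mem_append_left _ ?_)⟩
              refine List.mem_map.2 ⟨d, List.mem_filter.2 ⟨?_, hd⟩, rfl⟩
              fin_cases d <;> simp
            · refine ⟨(ht p hp).1, fun d hd => ?_⟩
              rcases (ht p hp).2 d hd with h | h
              · exact Or.inl (Or.inr h)
              · rcases List.mem_cons.1 h with h | h
                · exact Or.inl (Or.inl h)
                · exact Or.inr (List.mem_append_right _ h))
          rw [StateTree.states_insert] at h1
          exact ⟨V, fun p hp => h1 p (Or.inr hp), by
            simpa using ⟨h1 q (Or.inl rfl), fun p hp => h2 p (List.mem_append_right _ hp)⟩, h3⟩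

theorem accept_of_explore {f : ℕ} (h : explore key M allow f [M.init] .leaf = true)
    {S : TernaryString} (hS : ∀ d T, d :: T <:+ S → allow d (M.read T) = true) :
    M.accept (M.read S) = true := by
  obtain ⟨V, -, hw, hV⟩ := exists_closed_of_explore h (by simp [StateTree.states])
  suffices M.read S ∈ V from (hV _ this).1
  induction S with
  | nil => exact hw _ (by simp [Reader.read])
  | cons a l ih =>
    refine (hV _ (ih fun d T hT => hS d T (hT.trans (List.suffix_cons a l)))).2 a ?_
    exact hS a l List.suffix_rfl

end Explore

/-- Whether the digit `d` may be put in front of a string whose first run consists of `n` digits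
`e`, if runs of a digit `c` may have length at most `b c`. -/
def allowRun (b : Fin 3 → ℕ) (d : Fin 3) (n : ℕ) (e : Fin 3) : Bool :=
  bif Nat.beq d.val e.val then Nat.blt n (b d) else true

/-- As `allowRun`, but the digit `0` is allowed at the end of a string only. -/
def allowTerminal (b : Fin 3 → ℕ) (d : Fin 3) (n : ℕ) (e : Fin 3) : Bool :=
  bif Nat.beq n 0 then true else bif Nat.beq d.val 0 then false else allowRun b d n e

theorem RunsLE.of_suffix {b : Fin 3 → ℕ} {S T : TernaryString} (h : RunsLE b S) (hT : T <:+ S) :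
    RunsLE b T := by
  obtain ⟨A, rfl⟩ := hT
  induction A with
  | nil => exact h
  | cons a A ih => exact ih (RunsLE.of_cons h)

theorem RunsLE.allowRun {b : Fin 3 → ℕ} {d : Fin 3} {T : TernaryString} (h : RunsLE b (d :: T))
    (hb : ∀ d, 0 < b d) :
    allowRun b d ((runs T).headD (0, 0)).1 ((runs T).headD (0, 0)).2 = true := by
  unfold TernaryString.allowRun
  cases hd : Nat.beq d.val ((runs T).headD (0, 0)).2.val with
  | false => rfl
  | true =>
    have hd' : d = ((runs T).headD (0, 0)).2 := Fin.ext (Nat.eq_of_beq_eq_true hd)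
    rw [cond_true, Nat.blt_eq]
    rcases hT : runs T with _ | ⟨⟨n, c⟩, t⟩
    · exact hb d
    · rw [hT] at hd'
      have hd' : d = c := hd'
      subst hd'
      exact h (n + 1, d) (by simp [runs_cons_of_runs_eq hT])

theorem RunsLE.allowTerminal {b : Fin 3 → ℕ} {d : Fin 3} {T : TernaryString}
    (h : RunsLE b (d :: T)) (hb : ∀ d, 0 < b d) (h0 : 0 ∉ (d :: T).dropLast) :
    allowTerminal b d ((runs T).headD (0, 0)).1 ((runs T).headD (0, 0)).2 = true := by
  unfold TernaryString.allowTerminal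
  cases T with
  | nil => rfl
  | cons c T =>
    have hd : d ≠ 0 := by
      rintro rfl
      exact h0 (by simp)
    rw [beq_val_zero, decide_eq_false hd, h.allowRun hb]
    simp

/-! ### Reading particle chains -/

/-- The natural number with base-3 numeral `1` followed by the reverse of `p`. -/
def code (p : TernaryString) : ℕ := p.foldr (fun d k => Nat.add (Nat.mul 3 k) d.val) 1

theorem code_pos (p : TernaryString) : 0 < code p := by
  induction p with
  | nil => exact Nat.one_pos
  | cons d p ih =>
    change 0 < 3 * code p + d.val
    omega

theorem code_injective : Function.Injective code := by
  intro p
  induction p with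
  | nil =>
    rintro (_ | ⟨e, q⟩) h
    · rfl
    · have := code_pos q
      change 1 = 3 * code q + e.val at h
      omega
  | cons d p ih =>
    rintro (_ | ⟨e, q⟩) h
    · have := code_pos p
      change 3 * code p + d.val = 1 at h
      omega
    · change 3 * code p + d.val = 3 * code q + e.val at h
      have hd := d.isLt
      have he := e.isLt
      rw [ih (show code p = code q by omega), show d = e from Fin.ext (by omega)]

/-- The number whose binary digits `1` stand at the codes of the members of a list. -/
def mask (L : List TernaryString) : ℕ := L.foldr (fun p m => Nat.lor (Nat.pow 2 (code p)) m) 0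

/-- The binary digit of `m` at position `k`, as a truth value. -/
def bitAt (m k : ℕ) : Bool := Nat.beq (Nat.land (Nat.shiftRight m k) 1) 1

theorem mem_of_bitAt_mask {L : List TernaryString} {p : TernaryString}
    (h : bitAt (mask L) (code p) = true) : p ∈ L := by
  replace h : (mask L).testBit (code p) = true := by
    have := Nat.eq_of_beq_eq_true h
    change (mask L >>> code p) &&& 1 = 1 at this
    rw [Nat.and_one_is_mod] at this
    rw [Nat.testBit_eq_decide_div_mod_eq, ← Nat.shiftRight_eq_div_pow, this]
    rfl
  induction L with
  | nil => simp [mask] at h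
  | cons q L ih =>
    change (2 ^ code q ||| mask L).testBit (code p) = true at h
    rw [Nat.testBit_or, Nat.testBit_two_pow, Bool.or_eq_true, decide_eq_true_eq] at h
    rcases h with h | h
    · exact List.mem_cons.2 (Or.inl (code_injective h.symm))
    · exact List.mem_cons_of_mem _ (ih h)

/-- The common particles as a bit mask. -/
def commonMask : ℕ := mask commonParticles

/-- The particles of `separable d` as a bit mask, by cases of constants so that each mask is
computed only once. -/
def separableMask (d : Fin 3) : ℕ :=
  bif Nat.beq d.val 0 then mask (separable 0) else
  bif Nat.beq d.val 1 then mask (separable 1) else mask (separable 2)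

/-- The reader that decomposes a string into a particle chain. Its state is the code of the part of
the string in front of the particles found so far. That part is taken for a particle as soon as it
may stand behind the next digit. -/
def parser : Reader ℕ where
  init := 1
  step d c := bif bitAt (separableMask d) c then Nat.add 3 d.val else Nat.add (Nat.mul 3 c) d.val
  accept c := Nat.beq c 1 || bitAt commonMask c

theorem separableMask_eq (d : Fin 3) : separableMask d = mask (separable d) := by
  unfold separableMask
  generalize mask = m
  fin_cases d <;> rfl

/-- The state of `parser` is the code of an unfinished piece `b` in front of a particle chain `P`
that may stand behind the last digit of `b`. -/
theorem exists_read_parser (S : TernaryString) : ∃ b P, S = b ++ P.flatten ∧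
    parser.read S = code b ∧ IsParticleChain P ∧
    (∀ d ∈ b.getLast?, ∀ q ∈ P.head?, q ∈ separable d) ∧ (b = [] → P = []) := by
  induction S with
  | nil => exact ⟨[], [], rfl, rfl, ⟨by simp, by simp⟩, by simp, fun _ => rfl⟩
  | cons a l ih =>
    obtain ⟨b, P, rfl, hr, hP, hbP, hb⟩ := ih
    have hstep : parser.read (a :: (b ++ P.flatten)) = parser.step a (code b) :=
      congrArg _ hr
    cases hs : bitAt (separableMask a) (code b) with
    | true =>
      rw [separableMask_eq] at hs
      have hmem := mem_of_bitAt_mask hs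
      refine ⟨[a], b :: P, by simp, ?_, ⟨?_, ?_⟩, by simpa using hmem, by simp⟩
      · rw [hstep]
        simp only [parser, separableMask_eq, hs, cond_true]
        rfl
      · simpa using ⟨mem_common_of_mem_separable hmem, hP.1⟩
      · cases P with
        | nil => simp
        | cons q P => exact List.isChain_cons_cons.2 ⟨fun d hd => hbP d hd q (by simp), hP.2⟩
    | false =>
      refine ⟨a :: b, P, by simp, ?_, hP, ?_, by simp⟩
      · rw [hstep]
        simp only [parser, hs, cond_false]
        rfl
      · cases b with
        | nil => simp [hb rfl]
        | cons c b => simpa using hbP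

theorem decomposes_of_accept {S : TernaryString} (h : parser.accept (parser.read S) = true) :
    Decomposes S := by
  obtain ⟨b, P, rfl, hr, hP, hbP, hb⟩ := exists_read_parser S
  rw [hr] at h
  rcases (Bool.or_eq_true _ _).mp h with h | h
  · have hb0 : b = [] := code_injective (Nat.eq_of_beq_eq_true h)
    exact ⟨[], ⟨by simp, by simp⟩, by simp [hb0, hb hb0]⟩
  · refine ⟨b :: P, ⟨by simpa using ⟨mem_of_bitAt_mask h, hP.1⟩, ?_⟩, rfl⟩
    cases P with
    | nil => simp
    | cons q P => exact List.isChain_cons_cons.2 ⟨fun d hd => hbP d hd q (by simp), hP.2⟩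

theorem decomposes_of_explore {b : Fin 3 → ℕ} (hb : ∀ d, 0 < b d) {n f : ℕ}
    (h : explore (LookState.key (fun c => c) (n + 1)) (parser.lookIter (n + 1))
      (fun d q => allowTerminal b d q.1 q.2.1) f [(parser.lookIter (n + 1)).init] .leaf = true)
    {S : TernaryString} (hS : RunsLE b S) (h0 : 0 ∉ S.dropLast) :
    Decomposes (iter (n + 1) S) := by
  refine decomposes_of_accept ?_
  rw [← Reader.accept_lookIter]
  refine accept_of_explore h fun d T hT => ?_
  change allowTerminal b d ((parser.lookIter n).look.read T).1
    ((parser.lookIter n).look.read T).2.1 = true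
  rw [Reader.read_look]
  refine (hS.of_suffix hT).allowTerminal hb fun hd => h0 ?_
  obtain ⟨A, rfl⟩ := hT
  rw [List.dropLast_append_of_ne_nil (by simp)]
  exact List.mem_append_right _ hd

/-! ### Reading runs of bounded length -/

/-- The reader that accepts the strings in which the runs of each digit `c` have length at most
`b c`. A state consists of the length and the digit of the run being read and of the truth value
of the bound for the completed runs. -/
def boundReader (b : Fin 3 → ℕ) : Reader (ℕ × Fin 3 × Bool) where
  init := (0, 0, true)
  step d s := bif Nat.beq d.val s.2.1.val then (s.1 + 1, s.2.1, s.2.2)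
    else (1, d, s.2.2 && Nat.ble s.1 (b s.2.1))
  accept s := s.2.2 && Nat.ble s.1 (b s.2.1)

theorem read_boundReader (b : Fin 3 → ℕ) (S : TernaryString) :
    (boundReader b).read S = (((runs S).headD (0, 0)).1, ((runs S).headD (0, 0)).2,
      (runs S).tail.all fun r => Nat.ble r.1 (b r.2)) := by
  induction S with
  | nil => rfl
  | cons a l ih =>
    change (boundReader b).step a ((boundReader b).read l) = _
    rw [ih]
    rcases hl : runs l with _ | ⟨⟨n, c⟩, t⟩
    · by_cases ha : a = 0
      · subst ha
        simp [boundReader, runs, hl]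
      · simp [boundReader, runs, hl, beq_val_zero, ha]
    · by_cases hac : a = c
      · subst hac
        simp [boundReader, runs, hl]
      · simp [boundReader, runs, hl, beq_val, hac, Bool.and_comm]

theorem runsLE_of_accept {b : Fin 3 → ℕ} {S : TernaryString}
    (h : (boundReader b).accept ((boundReader b).read S) = true) : RunsLE b S := by
  rw [read_boundReader] at h
  unfold RunsLE
  rcases hl : runs S with _ | ⟨⟨n, c⟩, t⟩
  · simp
  · rw [hl] at h
    have h := (Bool.and_eq_true _ _).mp h
    intro r hr
    rcases List.mem_cons.1 hr with rfl | hr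
    · exact Nat.le_of_ble_eq_true h.2
    · exact Nat.le_of_ble_eq_true (List.all_eq_true.1 h.1 r hr)

/-! ### Languages whose iterates decompose -/

/-- The bounds that the runs of each digit meet in all late iterates. Runs `1111` persist, since
`11110` and `11112` are fixed points. -/
def lateBound : Fin 3 → ℕ
  | 0 => 1
  | 1 => 4
  | 2 => 3

/-- In the ten-fold iterate of a string with runs of length at most three and no `0` before the last
digit, every reachable state of the parser is accepting. The number 5000 of rounds is generous: fewer
than 300 states are reachable, and fewer than 700 in `explore_lateBound`. -/
theorem explore_essential :
    explore (LookState.key (fun c => c) 10) (parser.lookIter 10)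
      (fun d q => allowTerminal (fun _ => 3) d q.1 q.2.1) 5000
      [(parser.lookIter 10).init] .leaf = true := by
  decide +kernel

/-- As `explore_essential`, with runs `1111` allowed, which costs one more iteration. -/
theorem explore_lateBound :
    explore (LookState.key (fun c => c) 11) (parser.lookIter 11)
      (fun d q => allowTerminal lateBound d q.1 q.2.1) 5000
      [(parser.lookIter 11).init] .leaf = true := by
  decide +kernel

theorem explore_boundReader :
    explore (LookState.key (fun s => 3 * s.1 + s.2.1) 2) ((boundReader lateBound).lookIter 2)
      (fun d q => allowRun (fun _ => 5) d q.1 q.2.1) 5000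
      [((boundReader lateBound).lookIter 2).init] .leaf = true := by
  decide +kernel

theorem lateBound_pos (d : Fin 3) : 0 < lateBound d := by
  fin_cases d <;> decide

theorem RunsLE.iter_two {S : TernaryString} (h : RunsLE (fun _ => 5) S) :
    RunsLE lateBound (iter 2 S) := by
  refine runsLE_of_accept ?_
  rw [← Reader.accept_lookIter]
  refine accept_of_explore explore_boundReader fun d T hT => ?_
  change TernaryString.allowRun _ d (((boundReader lateBound).lookIter 1).look.read T).1
    (((boundReader lateBound).lookIter 1).look.read T).2.1 = true
  rw [Reader.read_look]
  exact (h.of_suffix hT).allowRun fun _ => by norm_num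

/-- A digit `0` separates what precedes from what follows for good, so that it suffices to treat
the strings in which only the last digit can be `0`. -/
theorem RunsLE.decomposes {S : TernaryString} (h : RunsLE lateBound S) :
    Decomposes (iter 11 S) := by
  induction hk : S.length using Nat.strong_induction_on generalizing S with
  | _ k ih =>
    by_cases h0 : 0 ∈ S.dropLast
    swap
    · exact decomposes_of_explore lateBound_pos explore_lateBound h h0
    obtain ⟨A, C, hA, hS⟩ : ∃ A C, (0 : Fin 3) ∉ A ∧ S.dropLast = A ++ 0 :: C := by
      obtain ⟨A, C, hAC, hA⟩ := List.eq_append_cons_of_mem h0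
      exact ⟨A, C, hA, hAC⟩
    have hne : S ≠ [] := by rintro rfl; simp at h0
    obtain ⟨B, hB, hSB⟩ : ∃ B : TernaryString, B ≠ [] ∧ S = A ++ 0 :: B :=
      ⟨C ++ [S.getLast hne], by simp, by
        conv_lhs => rw [← List.dropLast_append_getLast hne, hS]
        simp⟩
    have hlast : ∀ T : TernaryString, ∀ d ∈ A.getLast?, (0 :: T : TernaryString).head? ≠ some d := by
      intro T d hd h1
      rw [List.head?_cons, Option.some_inj] at h1
      exact hA (h1 ▸ List.mem_of_mem_getLast? hd)
    have hB0 : B.head? ≠ some 0 := by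
      intro hB0
      obtain ⟨B', rfl⟩ : ∃ B', B = 0 :: B' := by
        cases B with
        | nil => simp at hB0
        | cons b B => exact ⟨B, by simpa using hB0⟩
      unfold RunsLE at h
      rw [hSB, runs_append (hlast _)] at h
      rcases hr : runs (0 :: B') with _ | ⟨⟨n, c⟩, t⟩
      · exact runs_ne_nil (by simp) hr
      · have hc : c = 0 := by
          have := head?_runs (0 :: B')
          rw [hr] at this
          exact Option.some.inj this
        subst hc
        have hn := pos_of_mem_runs (S := 0 :: B') (n, 0) (by simp [hr])
        have := h (n + 1, 0) (by simp [runs_cons_of_runs_eq hr])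
        change n + 1 ≤ 1 at this
        change 0 < n at hn
        omega
    have hA0 : ∀ d ∈ (A ++ [0]).getLast?, d = (0 : Fin 3) := by simp [eq_comm]
    have hSAB : S = (A ++ [0]) ++ B := by simp [hSB]
    have hruns : runs S = runs (A ++ [0]) ++ runs B := by
      rw [hSAB]
      exact runs_append fun d hd => hA0 d hd ▸ hB0
    have h1 : RunsLE lateBound (A ++ [0]) := fun r hr =>
      h r (by rw [hruns]; exact List.mem_append_left _ hr)
    have h2 : RunsLE lateBound B := fun r hr =>
      h r (by rw [hruns]; exact List.mem_append_right _ hr)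
    rw [hSAB, iter_append fun n d hd => hA0 d hd ▸ head?_iter_ne_zero hB0 n]
    refine Decomposes.append ?_ (ih _ ?_ h2 rfl) ?_
    · exact decomposes_of_explore lateBound_pos explore_lateBound h1 (by simpa using hA)
    · rw [← hk, hSAB]
      simp only [List.length_append, List.length_singleton]
      omega
    · rw [getLast?_iter]
      simp

end TernaryString

theorem mainTheorem2 :
    (∀ S : TernaryString, S.EssentialAncient →
      ∃ n : ℕ, n ≤ 10 ∧ (TernaryString.iter n S).SplitsIntoCommon) ∧
    (∀ S : TernaryString, S.EventuallyCommon) := by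
  refine ⟨fun S hS => ⟨10, le_rfl, ?_⟩, fun S => ?_⟩
  · exact (TernaryString.decomposes_of_explore (fun _ => by norm_num)
      TernaryString.explore_essential (TernaryString.runsLE_of_not_infix hS.no_long_run)
      hS.zero_notMem).splitsIntoCommon
  · obtain ⟨n, hn⟩ := TernaryString.exists_runsLE_five S
    refine ⟨11 + (2 + n), ?_⟩
    rw [TernaryString.iter_add, TernaryString.iter_add]
    exact hn.iter_two.decomposes.splitsIntoCommon
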